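/- Let $s(n,k)$ denote the (signed) Stirling numbers of the first kind, defined by $\frac{[\ln(1+x)]^k}{k!}=\sum_{n=k}^\infty s(n,k)\frac{x^n}{n!}$ for $|x|<1$, and for integers $k\ge 1$, $m\ge 2$ put $$Q(k,m)=\sum_{\ell=0}^{m}\binom{k+\ell-1}{k-1}\,s(k+m-1,k+\ell-1)\left(\frac{k+m-2}{2}\right)^{\ell}.$$ Then for every integer $k\ge 1$ and every real $x$ with $|x|<1$, $$\left[\frac{(\arccos x)^2}{2(1-x)}\right]^k=1+(2k)!\sum_{n=1}^{\infty}\frac{Q(2k,2n)}{(2k+2n)!}\,[2(x-1)]^n$$ and $$\left[\frac{(\operatorname{arccosh} x)^2}{2(x-1)}\right]^k=1+(2k)!\sum_{n=1}^{\infty}\frac{Q(2k,2n)}{(2k+2n)!}\,[2(x-1)]^n,$$ where the series converges absolutely, and $\operatorname{arccosh} z=\ln\left(z+\sqrt{z+1}\,\sqrt{z-1}\right)$ is the principal branch of the complex inverse hyperbolic cosine. -/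

import Mathlib

/-- The (signed) Stirling numbers of the first kind `s(n, k)`, with
`(log (1 + x)) ^ k / k! = ∑_{n ≥ k} s(n, k) x ^ n / n!`. In terms of the unsigned numbers of
Mathlib (permutations of `n` elements with `k` cycles) the sign is `(-1) ^ (n - k)`, which is
`(-1) ^ (n + k)`. -/
def signedStirlingFirst (n k : ℕ) : ℤ :=
  (-1) ^ (n + k) * (Nat.stirlingFirst n k : ℤ)

/-- `Q(k, m) = ∑_{ℓ = 0}^{m} C(k + ℓ - 1, k - 1) s(k + m - 1, k + ℓ - 1) ((k + m - 2) / 2) ^ ℓ`,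
for `k ≥ 1` and `m ≥ 2` (no natural-number subtraction truncates in this range). -/
noncomputable def stirlingQ (k m : ℕ) : ℝ :=
  ∑ l ∈ Finset.range (m + 1),
    (Nat.choose (k + l - 1) (k - 1) : ℝ) * (signedStirlingFirst (k + m - 1) (k + l - 1) : ℝ)
      * (((k : ℝ) + (m : ℝ) - 2) / 2) ^ l

/-- The principal branch of the inverse hyperbolic cosine,
`arccosh z = log (z + √(z + 1) √(z - 1))`, with principal logarithm and square roots. -/
noncomputable def complexArccosh (z : ℂ) : ℂ :=
  Complex.log (z + Complex.sqrt (z + 1) * Complex.sqrt (z - 1))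

/-!
Writing `2 * k + 2 * n = 2 * (a + 1)`, the number `Q(2k, 2n)` is a coefficient of the falling
factorial of length `2 * a + 1` recentred at its midpoint `a`, that is, of
`X * ∏_{1 ≤ j ≤ a} (X ^ 2 - j ^ 2)`: it is a central factorial number. The recurrence for these
numbers says that `G_k(v) = ∑ n, t(2n, 2k) / (2n)! * v ^ n` satisfies
`(4 * v + v ^ 2) * G_{k+1}'' + (v + 2) * G_{k+1}' = G_k`, and under `v = 2 * (cosh w - 1)` the left
side is the second derivative of `w ↦ G_{k+1}(v)`. Hence, by induction on `k`,
`G_k(2 * (cosh w - 1)) = w ^ (2 * k) / (2 * k)!` on a connected neighbourhood of `w = 0`.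
Both identities are instances of this one, with `w = i * arccos x` and `w = arccosh x`.
-/

section CentralFactorial

open Polynomial

variable (R : Type*) [CommRing R]

theorem coeff_descPochhammer (n k : ℕ) :
    (descPochhammer R n).coeff k = (signedStirlingFirst n k : R) := by
  induction n generalizing k with
  | zero => cases k <;> simp [signedStirlingFirst, coeff_one]
  | succ n ih =>
    rw [descPochhammer_succ_right, mul_sub, coeff_sub, ← C_eq_natCast, coeff_mul_C]
    cases k with
    | zero => cases n <;> simp [ih, signedStirlingFirst]
    | succ k =>
      rw [coeff_mul_X, ih, ih]
      simp only [signedStirlingFirst, Nat.stirlingFirst_succ_succ]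
      push_cast
      ring

variable {R} in
theorem coeff_taylor_descPochhammer (r : R) (k m : ℕ) :
    (taylor r (descPochhammer R (k + m))).coeff k =
      ∑ l ∈ Finset.range (m + 1),
        ((k + l).choose k : R) * (signedStirlingFirst (k + m) (k + l) : R) * r ^ l := by
  have hdeg : (descPochhammer R (k + m)).natDegree ≤ k + m := by
    rw [← descPochhammer_map (Int.castRingHom R)]
    exact natDegree_map_le.trans (descPochhammer_natDegree ℤ _).le
  have hlt : (hasseDeriv k (descPochhammer R (k + m))).natDegree < m + 1 :=
    (natDegree_hasseDeriv_le _ _).trans_lt (by lia)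
  rw [taylor_coeff, eval_eq_sum_range' hlt]
  refine Finset.sum_congr rfl fun l _ ↦ ?_
  rw [hasseDeriv_coeff, coeff_descPochhammer, add_comm l]

theorem stirlingQ_succ (k m : ℕ) :
    stirlingQ (k + 1) m =
      (taylor (((k : ℝ) + m - 1) / 2) (descPochhammer ℝ (k + m))).coeff k := by
  rw [coeff_taylor_descPochhammer, stirlingQ]
  refine Finset.sum_congr rfl fun l _ ↦ ?_
  simp only [Nat.add_right_comm k 1, Nat.add_sub_cancel]
  push_cast
  ring

/-- The polynomial `∏_{j < n} (X - j ^ 2)`, whose coefficients are the central factorial numbers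
of even indices: its coefficient at `X ^ k` is `t(2n, 2k)`. -/
noncomputable def centralFactorialPoly (n : ℕ) : R[X] :=
  ∏ j ∈ Finset.range n, (X - C ((j : R) ^ 2))

theorem centralFactorialPoly_succ (n : ℕ) :
    centralFactorialPoly R (n + 1) = centralFactorialPoly R n * (X - C ((n : R) ^ 2)) :=
  Finset.prod_range_succ _ n

theorem monic_centralFactorialPoly (n : ℕ) : (centralFactorialPoly R n).Monic :=
  monic_prod_X_sub_C _ _

theorem natDegree_centralFactorialPoly [Nontrivial R] (n : ℕ) :
    (centralFactorialPoly R n).natDegree = n := by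
  rw [centralFactorialPoly, natDegree_prod_of_monic _ _ fun _ _ ↦ monic_X_sub_C _]
  simp only [natDegree_X_sub_C, Finset.sum_const, Finset.card_range, smul_eq_mul, mul_one]

theorem coeff_zero_centralFactorialPoly_succ (n : ℕ) :
    (centralFactorialPoly R (n + 1)).coeff 0 = 0 := by
  simp [centralFactorialPoly, Finset.prod_range_succ']

theorem coeff_succ_centralFactorialPoly_succ (n k : ℕ) :
    (centralFactorialPoly R (n + 1)).coeff (k + 1) =
      (centralFactorialPoly R n).coeff k
        - (n : R) ^ 2 * (centralFactorialPoly R n).coeff (k + 1) := by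
  rw [centralFactorialPoly_succ, mul_sub, coeff_sub, coeff_mul_X, coeff_mul_C, mul_comm]

-- Both sides are `X² ∏_{1 ≤ j ≤ a} (X - j) (X + j)`.
theorem X_mul_taylor_descPochhammer (a : ℕ) :
    X * taylor (a : R) (descPochhammer R (2 * a + 1)) =
      expand R 2 (centralFactorialPoly R (a + 1)) := by
  induction a with
  | zero => simp [centralFactorialPoly, sq]
  | succ a ih =>
    have hstep : taylor ((a + 1 : ℕ) : R) (descPochhammer R (2 * (a + 1) + 1)) =
        (X + C ((a : R) + 1)) * taylor (a : R) (descPochhammer R (2 * a + 1))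
          * (X - C ((a : R) + 1)) := by
      have hcomp : (X - 1 : R[X]).comp (X + C ((a + 1 : ℕ) : R)) = X + C (a : R) := by
        simp [← add_assoc]
      rw [show 2 * (a + 1) + 1 = 2 * a + 1 + 1 + 1 by ring, descPochhammer_succ_left,
        descPochhammer_succ_right, taylor_apply, mul_comp, comp_assoc, hcomp, mul_comp,
        taylor_apply]
      simp only [X_comp, sub_comp, natCast_comp, map_natCast, map_add, map_one]
      push_cast
      ring
    rw [hstep, centralFactorialPoly_succ, map_mul, ← ih]
    simp only [map_sub, expand_X, map_pow, map_add, map_natCast, map_one, Nat.cast_add,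
      Nat.cast_one]
    ring

theorem stirlingQ_two_mul {k : ℕ} (hk : 1 ≤ k) (n : ℕ) :
    stirlingQ (2 * k) (2 * n) = (centralFactorialPoly ℝ (k + n)).coeff k := by
  obtain ⟨k, rfl⟩ := Nat.exists_eq_add_of_le' hk
  have hcentre : (((2 * k + 1 : ℕ) : ℝ) + (2 * n : ℕ) - 1) / 2 = (k + n : ℕ) := by
    push_cast
    ring
  rw [show 2 * (k + 1) = 2 * k + 1 + 1 by ring, stirlingQ_succ, hcentre,
    show 2 * k + 1 + 2 * n = 2 * (k + n) + 1 by ring, ← coeff_X_mul, X_mul_taylor_descPochhammer,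
    show 2 * k + 1 + 1 = 2 * (k + 1) by ring, coeff_expand_mul' two_pos, Nat.add_right_comm]

end CentralFactorial

section NormedField

variable {𝕜 : Type*} [NontriviallyNormedField 𝕜]

theorem hasFPowerSeriesOnBall_deriv_ofScalars [CompleteSpace 𝕜] {f : 𝕜 → 𝕜} {a : ℕ → 𝕜} {x : 𝕜}
    {r : ENNReal}
    (h : HasFPowerSeriesOnBall f (FormalMultilinearSeries.ofScalars 𝕜 a) x r) :
    HasFPowerSeriesOnBall (deriv f)
      (FormalMultilinearSeries.ofScalars 𝕜 fun n ↦ ((n : 𝕜) + 1) * a (n + 1)) x r := by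
  convert! (ContinuousLinearMap.apply 𝕜 𝕜 (1 : 𝕜)).comp_hasFPowerSeriesOnBall h.fderiv
  ext n
  simp

theorem hasSum_of_hasFPowerSeriesOnBall_ofScalars {f : 𝕜 → 𝕜} {a : ℕ → 𝕜} {r : ENNReal}
    (h : HasFPowerSeriesOnBall f (FormalMultilinearSeries.ofScalars 𝕜 a) 0 r) {v : 𝕜}
    (hv : v ∈ Metric.eball 0 r) : HasSum (fun n ↦ a n * v ^ n) (f v) := by
  simpa [mul_comm] using h.hasSum hv

theorem hasSum_mul_pow_shift {c : ℕ → 𝕜} {v s : 𝕜}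
    (h : HasSum (fun n ↦ c (n + 1) * v ^ n) s) :
    HasSum (fun n ↦ c n * v ^ n) (c 0 + v * s) := by
  rw [← hasSum_nat_add_iff' 1]
  simpa [pow_succ', mul_left_comm] using h.mul_left v

theorem hasDerivAt_pow_succ_div_factorial [CharZero 𝕜] (m : ℕ) (w : 𝕜) :
    HasDerivAt (fun w : 𝕜 ↦ w ^ (m + 1) / ((m + 1).factorial : 𝕜)) (w ^ m / (m.factorial : 𝕜))
      w := by
  refine ((hasDerivAt_pow (m + 1) w).div_const _).congr_deriv ?_
  have : (m.factorial : 𝕜) ≠ 0 := mod_cast m.factorial_ne_zero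
  have : (m + 1 : 𝕜) ≠ 0 := mod_cast m.succ_ne_zero
  rw [Nat.factorial_succ, Nat.add_sub_cancel]
  push_cast
  field_simp

end NormedField

theorem eqOn_of_hasDerivAt_hasDerivAt {𝕜 : Type*} [RCLike 𝕜] {f f' g g' h : 𝕜 → 𝕜} {s : Set 𝕜}
    {x : 𝕜} (hs : IsOpen s) (hs' : IsPreconnected s)
    (hf : ∀ y ∈ s, HasDerivAt f (f' y) y) (hf' : ∀ y ∈ s, HasDerivAt f' (h y) y)
    (hg : ∀ y ∈ s, HasDerivAt g (g' y) y) (hg' : ∀ y ∈ s, HasDerivAt g' (h y) y)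
    (hx : x ∈ s) (hfg : f x = g x) (hfg' : f' x = g' x) : s.EqOn f g := by
  have eqOn_of_eq_deriv {u v w : 𝕜 → 𝕜} (hu : ∀ y ∈ s, HasDerivAt u (w y) y)
      (hv : ∀ y ∈ s, HasDerivAt v (w y) y) (huv : u x = v x) : s.EqOn u v :=
    hs.eqOn_of_deriv_eq hs' (fun y hy ↦ (hu y hy).differentiableAt.differentiableWithinAt)
      (fun y hy ↦ (hv y hy).differentiableAt.differentiableWithinAt)
      (fun y hy ↦ (hu y hy).deriv.trans (hv y hy).deriv.symm) hx huv
  have heq : s.EqOn f' g' := eqOn_of_eq_deriv hf' hg' hfg'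
  exact eqOn_of_eq_deriv hf (fun y hy ↦ heq hy ▸ hg y hy) hfg

theorem inv_centralBinom_succ (n : ℕ) :
    2 * (2 * (n : ℝ) + 1) * ((n + 1).centralBinom : ℝ)⁻¹ =
      ((n : ℝ) + 1) * (n.centralBinom : ℝ)⁻¹ := by
  have hpos : (0 : ℝ) < n.centralBinom := mod_cast n.centralBinom_pos
  have hpos' : (0 : ℝ) < (n + 1).centralBinom := mod_cast (n + 1).centralBinom_pos
  have hrec : ((n : ℝ) + 1) * (n + 1).centralBinom = 2 * (2 * n + 1) * n.centralBinom :=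
    mod_cast n.succ_mul_centralBinom_succ
  field_simp
  linear_combination (-1 : ℝ) * hrec

theorem radius_ofScalars_inv_centralBinom :
    (FormalMultilinearSeries.ofScalars ℝ fun n ↦ (n.centralBinom : ℝ)⁻¹).radius = 4 := by
  refine FormalMultilinearSeries.ofScalars_radius_eq_of_tendsto (r := 4) _ _ four_ne_zero ?_
  have hratio (n : ℕ) : ‖(n.centralBinom : ℝ)⁻¹‖ / ‖(n.succ.centralBinom : ℝ)⁻¹‖ =
      4 - 2 * (1 / ((n : ℝ) + 1)) := by
    have hne : ((n + 1).centralBinom : ℝ)⁻¹ ≠ 0 :=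
      inv_ne_zero (mod_cast (n + 1).centralBinom_ne_zero)
    rw [norm_inv, norm_inv, Real.norm_natCast, Real.norm_natCast, Nat.succ_eq_add_one,
      div_eq_iff hne]
    have hn : (n : ℝ) + 1 ≠ 0 := n.cast_add_one_ne_zero
    refine mul_left_cancel₀ hn ?_
    rw [← inv_centralBinom_succ]
    field_simp
    ring
  simp only [hratio]
  simpa using (tendsto_one_div_add_atTop_nhds_zero_nat (𝕜 := ℝ)).const_mul 2 |>.const_sub 4

section CoshCoeff

/-- The coefficient of `v ^ n` in the expansion of `w ^ (2 * k) / (2 * k)!` in powers of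
`v = 2 * cosh w - 2`. -/
noncomputable def coshCoeff (k n : ℕ) : ℝ :=
  (centralFactorialPoly ℝ n).coeff k / ((2 * n).factorial : ℝ)

theorem coshCoeff_of_lt {k n : ℕ} (h : n < k) : coshCoeff k n = 0 := by
  rw [coshCoeff, Polynomial.coeff_eq_zero_of_natDegree_lt, zero_div]
  rwa [natDegree_centralFactorialPoly]

theorem coshCoeff_self (k : ℕ) : coshCoeff k k = 1 / ((2 * k).factorial : ℝ) := by
  have h := (monic_centralFactorialPoly ℝ k).coeff_natDegree
  rw [natDegree_centralFactorialPoly] at h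
  rw [coshCoeff, h]

theorem coshCoeff_zero_succ (n : ℕ) : coshCoeff 0 (n + 1) = 0 := by
  rw [coshCoeff, coeff_zero_centralFactorialPoly_succ, zero_div]

theorem coshCoeff_add {k : ℕ} (hk : 1 ≤ k) (n : ℕ) :
    coshCoeff k (k + n) =
      stirlingQ (2 * k) (2 * n) / ((2 * k + 2 * n).factorial : ℝ) := by
  rw [coshCoeff, stirlingQ_two_mul hk, mul_add]

theorem coshCoeff_recurrence (k n : ℕ) :
    (2 * (n : ℝ) + 2) * (2 * n + 1) * coshCoeff (k + 1) (n + 1)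
      + (n : ℝ) ^ 2 * coshCoeff (k + 1) n = coshCoeff k n := by
  have hfact : ((2 * (n + 1)).factorial : ℝ) =
      (2 * (n : ℝ) + 2) * (2 * n + 1) * ((2 * n).factorial : ℝ) := by
    rw [show 2 * (n + 1) = 2 * n + 1 + 1 by ring, Nat.factorial_succ, Nat.factorial_succ]
    push_cast
    ring
  rw [coshCoeff, coshCoeff, coshCoeff, coeff_succ_centralFactorialPoly_succ, hfact]
  field_simp
  ring

theorem abs_coshCoeff_le_inv_centralBinom (k n : ℕ) :
    |coshCoeff k n| ≤ (n.centralBinom : ℝ)⁻¹ := by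
  induction n generalizing k with
  | zero =>
    cases k with
    | zero => simp [coshCoeff_self]
    | succ k => simp [coshCoeff_of_lt k.succ_pos]
  | succ n ih =>
    cases k with
    | zero => simp [coshCoeff_zero_succ]
    | succ k =>
      have hpos : 0 < (2 * (n : ℝ) + 2) * (2 * n + 1) := by positivity
      refine le_of_mul_le_mul_left ?_ hpos
      calc (2 * (n : ℝ) + 2) * (2 * n + 1) * |coshCoeff (k + 1) (n + 1)|
          = |coshCoeff k n - (n : ℝ) ^ 2 * coshCoeff (k + 1) n| := by
            rw [← coshCoeff_recurrence k n, add_sub_cancel_right, abs_mul, abs_of_pos hpos]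
        _ ≤ |coshCoeff k n| + (n : ℝ) ^ 2 * |coshCoeff (k + 1) n| := by
            refine (abs_sub _ _).trans_eq ?_
            rw [abs_mul, abs_of_nonneg (sq_nonneg (n : ℝ))]
        _ ≤ (n.centralBinom : ℝ)⁻¹ + (n : ℝ) ^ 2 * (n.centralBinom : ℝ)⁻¹ := by
            gcongr <;> exact ih _
        _ = (1 + (n : ℝ) ^ 2) * (n.centralBinom : ℝ)⁻¹ := by ring
        _ ≤ ((n : ℝ) + 1) ^ 2 * (n.centralBinom : ℝ)⁻¹ := by
            gcongr
            linarith [n.cast_nonneg (α := ℝ)]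
        _ = (2 * (n : ℝ) + 2) * (2 * n + 1) * ((n + 1).centralBinom : ℝ)⁻¹ := by
            linear_combination (-(n : ℝ) - 1) * inv_centralBinom_succ n

/-- The analytic function on the disc of radius `4` with Taylor coefficients `coshCoeff k`. -/
noncomputable def coshSeries (k : ℕ) (v : ℂ) : ℂ :=
  FormalMultilinearSeries.ofScalarsSum (fun n ↦ (coshCoeff k n : ℂ)) v

theorem hasFPowerSeriesOnBall_coshSeries (k : ℕ) :
    HasFPowerSeriesOnBall (coshSeries k)
      (FormalMultilinearSeries.ofScalars ℂ fun n ↦ (coshCoeff k n : ℂ)) 0 4 := by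
  have hradius : 4 ≤ (FormalMultilinearSeries.ofScalars ℂ fun n ↦ (coshCoeff k n : ℂ)).radius := by
    rw [← radius_ofScalars_inv_centralBinom]
    refine FormalMultilinearSeries.radius_le_of_le fun n ↦ ?_
    simpa [FormalMultilinearSeries.ofScalars_norm] using abs_coshCoeff_le_inv_centralBinom k n
  exact (FormalMultilinearSeries.hasFPowerSeriesOnBall _ (four_pos.trans_le hradius)).mono
    four_pos hradius

theorem coshSeries_ode (k : ℕ) {v : ℂ} (hv : v ∈ Metric.eball 0 4) :
    (4 * v + v ^ 2) * deriv (deriv (coshSeries (k + 1))) v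
      + (v + 2) * deriv (coshSeries (k + 1)) v = coshSeries k v := by
  let a (n : ℕ) : ℂ := coshCoeff (k + 1) n
  have hp := hasFPowerSeriesOnBall_coshSeries (k + 1)
  have hp' := hasFPowerSeriesOnBall_deriv_ofScalars hp
  have hp'' := hasFPowerSeriesOnBall_deriv_ofScalars hp'
  have h₁ := hasSum_of_hasFPowerSeriesOnBall_ofScalars hp' hv
  have h₂ := hasSum_of_hasFPowerSeriesOnBall_ofScalars hp'' hv
  have hv₁ : HasSum (fun n ↦ n * a n * v ^ n) (v * deriv (coshSeries (k + 1)) v) := by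
    simpa using hasSum_mul_pow_shift (c := fun n ↦ n * a n) (by simpa using h₁)
  have hv₂ : HasSum (fun n ↦ n * (n + 1) * a (n + 1) * v ^ n)
      (v * deriv (deriv (coshSeries (k + 1))) v) := by
    simpa using hasSum_mul_pow_shift (c := fun n ↦ n * (n + 1) * a (n + 1))
      (by simpa [mul_assoc] using h₂)
  have hvv₂ : HasSum (fun n ↦ (n - 1) * n * a n * v ^ n)
      (v * (v * deriv (deriv (coshSeries (k + 1))) v)) := by
    simpa using hasSum_mul_pow_shift (c := fun n ↦ (n - 1) * n * a n) (by simpa using hv₂)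
  have hrec (n : ℕ) :
      (2 * (n : ℂ) + 2) * (2 * n + 1) * a (n + 1) + (n : ℂ) ^ 2 * a n = coshCoeff k n := by
    have h := congrArg Complex.ofReal (coshCoeff_recurrence k n)
    push_cast at h
    exact h
  have hsum := (((hv₂.mul_left 4).add hvv₂).add hv₁).add (h₁.mul_left 2)
  have hk := hasSum_of_hasFPowerSeriesOnBall_ofScalars (hasFPowerSeriesOnBall_coshSeries k) hv
  have hterm (n : ℕ) : (coshCoeff k n : ℂ) * v ^ n =
      4 * (n * (n + 1) * a (n + 1) * v ^ n) + (n - 1) * n * a n * v ^ n + n * a n * v ^ n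
        + 2 * ((n + 1) * a (n + 1) * v ^ n) := by
    linear_combination -v ^ n * hrec n
  rw [funext hterm] at hk
  rw [hk.unique hsum]
  ring

theorem coshSeries_zero (v : ℂ) : coshSeries 0 v = 1 := by
  rw [coshSeries, FormalMultilinearSeries.ofScalars_sum_eq, tsum_eq_single 0]
  · simp [coshCoeff_self]
  · rintro (_ | n) hn
    · contradiction
    · simp [coshCoeff_zero_succ]

theorem coshSeries_succ_apply_zero (k : ℕ) : coshSeries (k + 1) 0 = 0 := by
  simp [coshSeries, coshCoeff_of_lt k.succ_pos]

end CoshCoeff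

section CoshDomain

/-- The component around `0` of the preimage under `cosh` of the disc of convergence
`‖z - 1‖ < 2`. -/
def coshDomain : Set ℂ :=
  {w | |w.im| < Real.pi ∧ ‖Complex.cosh w - 1‖ < 2}

theorem norm_cosh_sub_one (w : ℂ) :
    ‖Complex.cosh w - 1‖ = Real.cosh w.re - Real.cos w.im := by
  have hnonneg : 0 ≤ Real.cosh w.re - Real.cos w.im :=
    sub_nonneg.2 ((Real.cos_le_one _).trans (Real.one_le_cosh _))
  have hcosh : Complex.cosh w - 1 =
      ⟨Real.cosh w.re * Real.cos w.im - 1, Real.sinh w.re * Real.sin w.im⟩ := by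
    conv_lhs => rw [← Complex.re_add_im w, Complex.cosh_add, Complex.cosh_mul_I, Complex.sinh_mul_I]
    apply Complex.ext <;> simp [← Complex.ofReal_cosh, ← Complex.ofReal_sinh, ← Complex.ofReal_cos,
      ← Complex.ofReal_sin]
  rw [← sq_eq_sq₀ (norm_nonneg _) hnonneg, hcosh, Complex.sq_norm, Complex.normSq_mk]
  linear_combination (Real.cosh w.re ^ 2 - 1) * Real.sin_sq_add_cos_sq w.im
    - Real.sin w.im ^ 2 * Real.cosh_sq w.re

theorem isOpen_coshDomain : IsOpen coshDomain :=
  (isOpen_lt Complex.continuous_im.abs continuous_const).inter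
    (isOpen_lt (Complex.continuous_cosh.sub continuous_const).norm continuous_const)

theorem starConvex_coshDomain : StarConvex ℝ 0 coshDomain := by
  refine starConvex_zero_iff.2 fun w ⟨him, hnorm⟩ t ht₀ ht₁ ↦ ?_
  have habs (y : ℝ) : |t * y| ≤ |y| := by
    rw [abs_mul, abs_of_nonneg ht₀]
    exact mul_le_of_le_one_left (abs_nonneg y) ht₁
  have hcosh : Real.cosh (t * w.re) ≤ Real.cosh w.re := Real.cosh_le_cosh.2 (habs _)
  have hcos : Real.cos w.im ≤ Real.cos (t * w.im) := by
    rw [← Real.cos_abs w.im, ← Real.cos_abs (t * w.im)]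
    exact Real.cos_le_cos_of_nonneg_of_le_pi (abs_nonneg _) him.le (habs _)
  rw [norm_cosh_sub_one] at hnorm
  refine ⟨by simpa using (habs _).trans_lt him, ?_⟩
  rw [norm_cosh_sub_one, Complex.smul_re, Complex.smul_im, smul_eq_mul, smul_eq_mul]
  linarith

theorem zero_mem_coshDomain : (0 : ℂ) ∈ coshDomain := by
  simp [coshDomain, Real.pi_pos]

theorem isPreconnected_coshDomain : IsPreconnected coshDomain :=
  (starConvex_coshDomain.isPathConnected zero_mem_coshDomain).isConnected.isPreconnected

theorem two_mul_cosh_sub_one_mem_eball {w : ℂ} (hw : w ∈ coshDomain) :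
    2 * (Complex.cosh w - 1) ∈ Metric.eball (0 : ℂ) 4 := by
  have h4 : (4 : ENNReal) = ENNReal.ofReal 4 := by simp
  rw [h4, Metric.eball_ofReal, mem_ball_zero_iff, norm_mul, Complex.norm_two]
  linarith [hw.2]

theorem coshSeries_two_mul_cosh_sub_one (k : ℕ) {w : ℂ} (hw : w ∈ coshDomain) :
    coshSeries k (2 * (Complex.cosh w - 1)) = w ^ (2 * k) / ((2 * k).factorial : ℂ) := by
  induction k generalizing w with
  | zero => simp [coshSeries_zero]
  | succ k ih =>
    let v (w : ℂ) : ℂ := 2 * (Complex.cosh w - 1)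
    have hv (w : ℂ) : HasDerivAt v (2 * Complex.sinh w) w :=
      ((Complex.hasDerivAt_cosh w).sub_const 1).const_mul 2
    have hp := hasFPowerSeriesOnBall_coshSeries (k + 1)
    have hderiv {w : ℂ} (hw : w ∈ coshDomain) :=
      (hp.analyticAt_of_mem (two_mul_cosh_sub_one_mem_eball hw)).differentiableAt.hasDerivAt
    have hderiv' {w : ℂ} (hw : w ∈ coshDomain) :=
      (hp.analyticAt_of_mem (two_mul_cosh_sub_one_mem_eball hw)).deriv.differentiableAt.hasDerivAt
    refine eqOn_of_hasDerivAt_hasDerivAt isOpen_coshDomain isPreconnected_coshDomain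
      (f := coshSeries (k + 1) ∘ v)
      (f' := fun w ↦ deriv (coshSeries (k + 1)) (v w) * (2 * Complex.sinh w))
      (h := fun w ↦ w ^ (2 * k) / ((2 * k).factorial : ℂ))
      (fun w hw ↦ (hderiv hw).comp w (hv w)) (fun w hw ↦ ?_)
      (fun w _ ↦ hasDerivAt_pow_succ_div_factorial (2 * k + 1) w)
      (fun w _ ↦ hasDerivAt_pow_succ_div_factorial (2 * k) w)
      zero_mem_coshDomain ?_ ?_ hw
    · refine (((hderiv' hw).comp w (hv w)).mul
        ((Complex.hasDerivAt_sinh w).const_mul 2)).congr_deriv ?_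
      have hode := coshSeries_ode k (two_mul_cosh_sub_one_mem_eball hw)
      rw [ih hw] at hode
      rw [← hode]
      simp only [Function.comp_apply]
      linear_combination (-4 * deriv (deriv (coshSeries (k + 1))) (v w)) * Complex.cosh_sq w
    · simp [v, coshSeries_succ_apply_zero]
    · simp

theorem hasSum_coshCoeff (k : ℕ) {w : ℂ} (hw : w ∈ coshDomain) :
    HasSum (fun n ↦ (coshCoeff k n : ℂ) * (2 * (Complex.cosh w - 1)) ^ n)
      (w ^ (2 * k) / ((2 * k).factorial : ℂ)) :=
  coshSeries_two_mul_cosh_sub_one k hw ▸ hasSum_of_hasFPowerSeriesOnBall_ofScalars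
    (hasFPowerSeriesOnBall_coshSeries k) (two_mul_cosh_sub_one_mem_eball hw)

theorem hasSum_stirlingQ {k : ℕ} (hk : 1 ≤ k) {w : ℂ} (hw : w ∈ coshDomain)
    (hne : Complex.cosh w ≠ 1) :
    HasSum (fun n : ℕ+ ↦ (stirlingQ (2 * k) (2 * n) : ℂ) / ((2 * k + 2 * n).factorial : ℂ)
        * (2 * (Complex.cosh w - 1)) ^ (n : ℕ))
      (((w ^ 2 / (2 * (Complex.cosh w - 1))) ^ k - 1) / ((2 * k).factorial : ℂ)) := by
  set v := 2 * (Complex.cosh w - 1)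
  have hv₀ : v ≠ 0 := mul_ne_zero two_ne_zero (sub_ne_zero.2 hne)
  have hall : HasSum (fun n ↦ (coshCoeff k n : ℂ) * v ^ n)
      (w ^ (2 * k) / ((2 * k).factorial : ℂ)) := hasSum_coshCoeff k hw
  have hlow : ∑ i ∈ Finset.range k, (coshCoeff k i : ℂ) * v ^ i = 0 :=
    Finset.sum_eq_zero fun i hi ↦ by simp [coshCoeff_of_lt (Finset.mem_range.1 hi)]
  have hshift : HasSum (fun n ↦ (coshCoeff k (k + n) : ℂ) * v ^ n)
      ((w ^ 2 / v) ^ k / ((2 * k).factorial : ℂ)) := by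
    have h := ((hasSum_nat_add_iff' k).2 hall).div_const (v ^ k)
    rw [hlow, sub_zero] at h
    convert! h using 1
    · funext n
      rw [pow_add, add_comm k]
      field_simp
    · rw [div_pow, ← pow_mul]
      ring
  refine (hasSum_pnat_iff_hasSum_succ (f := fun n : ℕ ↦ (stirlingQ (2 * k) (2 * n) : ℂ)
    / ((2 * k + 2 * n).factorial : ℂ) * v ^ n)).2 ?_
  convert! (hasSum_nat_add_iff' 1).2 hshift using 1
  · funext n
    rw [coshCoeff_add hk]
    push_cast
    rfl
  · simp only [Finset.range_one, Finset.sum_singleton, add_zero, coshCoeff_self, one_div,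
      Complex.ofReal_inv, Complex.ofReal_natCast, pow_zero, mul_one]
    ring

theorem cosh_complexArccosh (z : ℂ) : Complex.cosh (complexArccosh z) = z := by
  have sqrt_sq (a : ℂ) : Complex.sqrt a ^ 2 = a := Complex.cpow_nat_inv_pow a two_ne_zero
  set s := Complex.sqrt (z + 1) * Complex.sqrt (z - 1) with hs
  have hmul : (z + s) * (z - s) = 1 := by
    linear_combination (-s - Complex.sqrt (z + 1) * Complex.sqrt (z - 1)) * hs
      - Complex.sqrt (z - 1) ^ 2 * sqrt_sq (z + 1) - (z + 1) * sqrt_sq (z - 1)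
  have hexp : Complex.exp (complexArccosh z) = z + s :=
    Complex.exp_log (left_ne_zero_of_mul_eq_one hmul)
  rw [Complex.cosh, Complex.exp_neg, hexp, inv_eq_of_mul_eq_one_right hmul]
  ring

theorem complexArccosh_mem_coshDomain {z : ℂ} (hz : ‖z - 1‖ < 2) :
    complexArccosh z ∈ coshDomain := by
  refine ⟨abs_lt.2 ⟨Complex.neg_pi_lt_log_im _, (Complex.log_im_le_pi _).lt_of_ne fun him ↦ ?_⟩,
    by rwa [cosh_complexArccosh]⟩
  have him' : (complexArccosh z).im = Real.pi := him
  have h := norm_cosh_sub_one (complexArccosh z)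
  rw [cosh_complexArccosh, him', Real.cos_pi] at h
  linarith [Real.one_le_cosh (complexArccosh z).re]

theorem cosh_arccos_mul_I {x : ℝ} (hx : |x| ≤ 1) :
    Complex.cosh (Real.arccos x * Complex.I) = x := by
  rw [Complex.cosh_mul_I, ← Complex.ofReal_cos,
    Real.cos_arccos (neg_le_of_abs_le hx) (le_of_abs_le hx)]

theorem norm_ofReal_sub_one_lt_two {x : ℝ} (hx : |x| < 1) : ‖(x : ℂ) - 1‖ < 2 := by
  refine (norm_sub_le _ _).trans_lt ?_
  rw [Complex.norm_real, Real.norm_eq_abs, norm_one]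
  linarith

theorem arccos_mul_I_mem_coshDomain {x : ℝ} (hx : |x| < 1) :
    Real.arccos x * Complex.I ∈ coshDomain := by
  have hlt : Real.arccos x < Real.pi :=
    (Real.arccos_le_pi x).lt_of_ne fun h ↦ (neg_lt_of_abs_lt hx).not_ge (Real.arccos_eq_pi.1 h)
  refine ⟨?_, ?_⟩
  · rwa [Complex.im_ofReal_mul, Complex.I_im, mul_one, abs_of_nonneg (Real.arccos_nonneg x)]
  · rw [cosh_arccos_mul_I hx.le]
    exact norm_ofReal_sub_one_lt_two hx

end CoshDomain

theorem summable_and_eq_one_add_mul_tsum {K ι : Type*} [Field K] [TopologicalSpace K] [T2Space K]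
    {f : ι → K} {a c : K} (hc : c ≠ 0) (hf : HasSum f ((a - 1) / c)) :
    Summable f ∧ a = 1 + c * ∑' i, f i := by
  refine ⟨hf.summable, ?_⟩
  rw [hf.tsum_eq, mul_div_cancel₀ _ hc, add_sub_cancel]

theorem hasSum_stirlingQ_arccos {k : ℕ} (hk : 1 ≤ k) {x : ℝ} (hx : |x| < 1) :
    HasSum (fun n : ℕ+ ↦ stirlingQ (2 * k) (2 * n) / ((2 * k + 2 * n).factorial : ℝ)
        * (2 * (x - 1)) ^ (n : ℕ))
      (((Real.arccos x ^ 2 / (2 * (1 - x))) ^ k - 1) / ((2 * k).factorial : ℝ)) := by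
  have hne : (x : ℂ) ≠ 1 := mod_cast (lt_of_abs_lt hx).ne
  have h := hasSum_stirlingQ hk (arccos_mul_I_mem_coshDomain hx)
    (by rwa [cosh_arccos_mul_I hx.le])
  have hsq : (Real.arccos x * Complex.I) ^ 2 / (2 * ((x : ℂ) - 1)) =
      (Real.arccos x : ℂ) ^ 2 / (2 * (1 - x)) := by
    rw [mul_pow, Complex.I_sq, mul_neg_one, ← neg_sub (1 : ℂ) x, mul_neg, neg_div_neg_eq]
  rw [cosh_arccos_mul_I hx.le, hsq] at h
  exact_mod_cast h

theorem theorem4p1_general {k : ℕ} (hk : 1 ≤ k) {z : ℂ} (hz : ‖z - 1‖ < 2) (hz₁ : z ≠ 1) :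
    Summable (fun n : ℕ+ ↦
        (stirlingQ (2 * k) (2 * n) : ℂ) / ((2 * k + 2 * n).factorial : ℂ)
          * (2 * (z - 1)) ^ (n : ℕ)) ∧
      (complexArccosh z ^ 2 / (2 * (z - 1))) ^ k =
        1 + ((2 * k).factorial : ℂ) * ∑' n : ℕ+,
          (stirlingQ (2 * k) (2 * n) : ℂ) / ((2 * k + 2 * n).factorial : ℂ)
            * (2 * (z - 1)) ^ (n : ℕ) := by
  have h := hasSum_stirlingQ hk (complexArccosh_mem_coshDomain hz)
    (by rwa [cosh_complexArccosh])
  rw [cosh_complexArccosh] at h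
  exact summable_and_eq_one_add_mul_tsum (mod_cast (2 * k).factorial_ne_zero) h

theorem theorem4p1 (k : ℕ) (hk : 1 ≤ k) (x : ℝ) (hx : |x| < 1) :
    (Summable (fun n : ℕ+ =>
        stirlingQ (2 * k) (2 * n) / ((2 * k + 2 * n).factorial : ℝ) * (2 * (x - 1)) ^ (n : ℕ)) ∧
      ((Real.arccos x) ^ 2 / (2 * (1 - x))) ^ k =
        1 + ((2 * k).factorial : ℝ) * ∑' n : ℕ+,
          stirlingQ (2 * k) (2 * n) / ((2 * k + 2 * n).factorial : ℝ)
            * (2 * (x - 1)) ^ (n : ℕ)) ∧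
    (Summable (fun n : ℕ+ =>
        (stirlingQ (2 * k) (2 * n) : ℂ) / ((2 * k + 2 * n).factorial : ℂ)
          * (2 * ((x : ℂ) - 1)) ^ (n : ℕ)) ∧
      ((complexArccosh (x : ℂ)) ^ 2 / (2 * ((x : ℂ) - 1))) ^ k =
        1 + ((2 * k).factorial : ℂ) * ∑' n : ℕ+,
          (stirlingQ (2 * k) (2 * n) : ℂ) / ((2 * k + 2 * n).factorial : ℂ)
            * (2 * ((x : ℂ) - 1)) ^ (n : ℕ)) :=
  ⟨summable_and_eq_one_add_mul_tsum (mod_cast (2 * k).factorial_ne_zero)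
      (hasSum_stirlingQ_arccos hk hx),
    theorem4p1_general hk (norm_ofReal_sub_one_lt_two hx) (mod_cast (lt_of_abs_lt hx).ne)⟩
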